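/- Let $n\ge 1$. For $t>0$ and $x,y\in\mathbb R^n$ let $$P_t(x,y)=\frac1{2\pi^{(n+1)/2}}\int_0^\infty \frac{t}{s^{3/2}}\,e^{-\frac{t^2}{4s}}\,\frac{e^{-\frac{|y-e^{-s}x|^2}{1-e^{-2s}}}}{(1-e^{-2s})^{n/2}}\,ds$$ be the Ornstein–Uhlenbeck Poisson kernel. If $x\neq0$, write $y=y_x+y_x'$ with $y_x$ parallel to $x$ and $y_x'$ orthogonal to $x$; if $x=0$, put $y_x=y$ and $y_x'=0$. Then there exist constants $C>0$ and $c>0$, depending only on $n$, such that for all $t>0$ and all $x,y\in\mathbb R^n$ $$P_t(x,y)\le C\,\bigl[K_1(t,x,y)+K_2(t,x,y)+K_3(t,x,y)+K_4(t,x,y)\bigr],$$ where $$K_1(t,x,y)=\frac{t}{(t^2+|x-y|^2)^{(n+1)/2}}\,\exp\bigl(-c\,t(1+|x|)\bigr),$$ $$K_2(t,x,y)=\frac{t}{|x|}\Bigl(t^2+\frac{|x-y_x|}{|x|}+|y_x'|^2\Bigr)^{-\frac{n+2}2}\exp\Bigl(-c\,\frac{(t^2+|y_x'|^2)\,|x|}{|x-y_x|}\Bigr)\,\chi_{\{|x|>1,\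 x\cdot y>0,\ |x|/2\le|y_x|<|x|\}},$$ $$K_3(t,x,y)=\min(1,t)\,\exp(-c\,|y|^2),$$ $$K_4(t,x,y)=\frac{t}{|y_x|}\Bigl(\log\frac{|x|}{|y_x|}\Bigr)^{-\frac32}\exp\Bigl(-c\,\frac{t^2}{\log(|x|/|y_x|)}\Bigr)\exp\bigl(-c\,|y_x'|^2\bigr)\,\chi_{\{x\cdot y>0,\ 1<|y_x|<|x|/2\}}.$$ Here $K_2$ and $K_4$ are understood to be $0$ outside the sets indicated by the characteristic functions. -/

import Mathlib

namespace OrnsteinUhlenbeck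

noncomputable section

/-- The space `ℝⁿ` with its Euclidean norm and inner product. -/
abbrev Rn (n : ℕ) := EuclideanSpace ℝ (Fin n)

/-- The Mehler kernel `M_r(x, y) = (1 - r²)^(-n/2) exp(-|y - r x|² / (1 - r²))`, for `0 < r < 1`. -/
def mehlerKernel {n : ℕ} (r : ℝ) (x y : Rn n) : ℝ :=
  Real.exp (-(‖y - r • x‖ ^ 2 / (1 - r ^ 2))) / (1 - r ^ 2) ^ ((n : ℝ) / 2)

/-- The integrand `t s^(-3/2) exp(-t²/(4s)) M_{e^{-s}}(x, y)` of the subordination formula. -/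
def poissonIntegrand {n : ℕ} (t : ℝ) (x y : Rn n) (s : ℝ) : ℝ :=
  t / s ^ (3 / 2 : ℝ) * Real.exp (-(t ^ 2 / (4 * s))) * mehlerKernel (Real.exp (-s)) x y

/-- The Ornstein-Uhlenbeck Poisson kernel `P_t(x, y)`, for `t > 0`:
`P_t(x, y) = 1 / (2 π^((n+1)/2)) ∫_0^∞ t s^(-3/2) exp(-t²/(4s)) M_{e^{-s}}(x, y) ds`. -/
def poissonKernel {n : ℕ} (t : ℝ) (x y : Rn n) : ℝ :=
  1 / (2 * Real.pi ^ (((n : ℝ) + 1) / 2)) * ∫ s in Set.Ioi (0 : ℝ), poissonIntegrand t x y s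

open Classical in
/-- The component `y_x` of `y` parallel to `x`: the orthogonal projection of `y` on the line
spanned by `x` if `x ≠ 0`, and `y` itself if `x = 0`. -/
def par {n : ℕ} (x y : Rn n) : Rn n :=
  if x = 0 then y else (Submodule.span ℝ {x}).starProjection y

/-- The component `y_x' = y - y_x` of `y` orthogonal to `x`. -/
def perp {n : ℕ} (x y : Rn n) : Rn n := y - par x y

/-- `expStar c X` is `exp(-c X)`, the quantity written `exp^*(-X)` when the constant `c > 0`
is left implicit. -/
def expStar (c X : ℝ) : ℝ := Real.exp (-(c * X))

/-- `K₁`, with the constant `c` of `exp^*` made explicit. -/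
def K1 {n : ℕ} (c t : ℝ) (x y : Rn n) : ℝ :=
  t / (t ^ 2 + ‖x - y‖ ^ 2) ^ (((n : ℝ) + 1) / 2) * expStar c (t * (1 + ‖x‖))

/-- `K₂`, with the constant `c` of `exp^*` made explicit. -/
def K2 {n : ℕ} (c t : ℝ) (x y : Rn n) : ℝ :=
  Set.indicator {z : Rn n | 1 < ‖x‖ ∧ 0 < inner ℝ x z ∧ ‖x‖ / 2 ≤ ‖par x z‖ ∧ ‖par x z‖ < ‖x‖}
    (fun z => t / ‖x‖ * (t ^ 2 + ‖x - par x z‖ / ‖x‖ + ‖perp x z‖ ^ 2) ^ (-(((n : ℝ) + 2) / 2))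
      * expStar c ((t ^ 2 + ‖perp x z‖ ^ 2) * ‖x‖ / ‖x - par x z‖)) y

/-- `K₃`, with the constant `c` of `exp^*` made explicit; it does not depend on `x`. -/
def K3 {n : ℕ} (c t : ℝ) (y : Rn n) : ℝ := min 1 t * expStar c (‖y‖ ^ 2)

/-- `K₄`, with the constant `c` of `exp^*` made explicit. -/
def K4 {n : ℕ} (c t : ℝ) (x y : Rn n) : ℝ :=
  Set.indicator {z : Rn n | 0 < inner ℝ x z ∧ 1 < ‖par x z‖ ∧ ‖par x z‖ < ‖x‖ / 2}
    (fun z => t / ‖par x z‖ * Real.log (‖x‖ / ‖par x z‖) ^ (-(3 / 2 : ℝ))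
      * expStar c (t ^ 2 / Real.log (‖x‖ / ‖par x z‖)) * expStar c (‖perp x z‖ ^ 2)) y

/-- The integral that defines `P_t(x, y)` converges absolutely for all `t > 0`. -/
theorem integrableOn_poissonIntegrand {n : ℕ} {t : ℝ} (ht : 0 < t) (x y : Rn n) :
    MeasureTheory.IntegrableOn (poissonIntegrand t x y) (Set.Ioi 0) := by
  have hr : ∀ s : ℝ, 0 < s → 0 < 1 - Real.exp (-s) ^ 2 := by
    intro s hs
    have h1 : Real.exp (-s) < 1 := by simpa using hs
    have h0 := Real.exp_pos (-s)
    nlinarith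
  have hcont : ContinuousOn (poissonIntegrand t x y) (Set.Ioi 0) := by
    unfold poissonIntegrand mehlerKernel
    have e1 : ContinuousOn (fun s : ℝ => s ^ (3 / 2 : ℝ)) (Set.Ioi 0) :=
      ContinuousOn.rpow_const continuousOn_id (fun s hs => Or.inl (ne_of_gt hs))
    have e2 : ContinuousOn (fun s : ℝ => (1 - Real.exp (-s) ^ 2) ^ ((n : ℝ) / 2)) (Set.Ioi 0) :=
      ContinuousOn.rpow_const (by fun_prop) (fun s hs => Or.inl (ne_of_gt (hr s hs)))
    refine ContinuousOn.mul (ContinuousOn.mul (ContinuousOn.div continuousOn_const e1 ?_) ?_)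
      (ContinuousOn.div ?_ e2 ?_)
    · exact fun s hs => (Real.rpow_pos_of_pos hs _).ne'
    · refine Real.continuous_exp.comp_continuousOn (ContinuousOn.neg ?_)
      refine ContinuousOn.div continuousOn_const (by fun_prop) ?_
      intro s hs
      have : (0 : ℝ) < s := hs
      positivity
    · refine Real.continuous_exp.comp_continuousOn (ContinuousOn.neg ?_)
      refine ContinuousOn.div (by fun_prop) (by fun_prop) ?_
      exact fun s hs => (hr s hs).ne'
    · exact fun s hs => (Real.rpow_pos_of_pos (hr s hs) _).ne'
  -- `1 - e^{-2s} ≥ s / (1 + s)`, so the integrand is at most a constant times `(1 + s)^(-3/2)`.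
  have hlow : ∀ s : ℝ, 0 < s → s / (1 + s) ≤ 1 - Real.exp (-s) ^ 2 := by
    intro s hs
    have h1 : Real.exp (-s) ≤ 1 / (1 + s) := by
      rw [Real.exp_neg, ← one_div]
      exact one_div_le_one_div_of_le (by positivity) (by linarith [Real.add_one_le_exp s])
    have h2 : Real.exp (-s) ≤ 1 := Real.exp_le_one_iff.2 (by linarith)
    have h0 := Real.exp_pos (-s)
    have h3 : s / (1 + s) = 1 - 1 / (1 + s) := by field_simp; ring
    nlinarith
  have hbd : ∃ A : ℝ, ∀ s : ℝ, 0 < s →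
      Real.exp (-(t ^ 2 / (4 * s))) * (1 + 1 / s) ^ ((n : ℝ) / 2 + 3 / 2) ≤ A := by
    have hnn : ∀ m : ℕ, ∀ s : ℝ, 0 < s → Real.exp (-(t ^ 2 / (4 * s))) * (1 + 1 / s) ^ m ≤
        m.factorial * Real.exp (t ^ 2 / 4) / (t ^ 2 / 4) ^ m := by
      intro m s hs
      have hz : 0 ≤ t ^ 2 / 4 * (1 + 1 / s) := by positivity
      have h := Real.pow_div_factorial_le_exp _ hz m
      have hf : (0 : ℝ) < m.factorial := by exact_mod_cast m.factorial_pos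
      rw [div_le_iff₀ hf, mul_pow] at h
      rw [le_div_iff₀ (by positivity)]
      calc Real.exp (-(t ^ 2 / (4 * s))) * (1 + 1 / s) ^ m * (t ^ 2 / 4) ^ m
          = Real.exp (-(t ^ 2 / (4 * s))) * ((t ^ 2 / 4) ^ m * (1 + 1 / s) ^ m) := by ring
        _ ≤ Real.exp (-(t ^ 2 / (4 * s))) *
            (Real.exp (t ^ 2 / 4 * (1 + 1 / s)) * m.factorial) := by gcongr
        _ = m.factorial * (Real.exp (-(t ^ 2 / (4 * s))) *
            Real.exp (t ^ 2 / 4 * (1 + 1 / s))) := by ring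
        _ = m.factorial * Real.exp (t ^ 2 / 4) := by
            rw [← Real.exp_add]
            congr 2
            field_simp
            ring
    refine ⟨_, fun s hs => le_trans ?_ (hnn (n + 2) s hs)⟩
    have h1 : (1 : ℝ) ≤ 1 + 1 / s := by
      have : 0 < 1 / s := by positivity
      linarith
    rw [← Real.rpow_natCast (1 + 1 / s) (n + 2)]
    refine mul_le_mul_of_nonneg_left (Real.rpow_le_rpow_of_exponent_le h1 ?_) (Real.exp_pos _).le
    have : (0 : ℝ) ≤ n := Nat.cast_nonneg n
    push_cast
    linarith
  obtain ⟨A, hA⟩ := hbd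
  have hbound : ∀ s : ℝ, 0 < s → ‖poissonIntegrand t x y s‖ ≤ t * A * (s + 1) ^ (-(3 / 2) : ℝ) := by
    intro s hs
    have hp := hr s hs
    have hnonneg : 0 ≤ poissonIntegrand t x y s := by
      unfold poissonIntegrand mehlerKernel
      positivity
    rw [Real.norm_of_nonneg hnonneg]
    have hM : mehlerKernel (Real.exp (-s)) x y ≤ (1 + 1 / s) ^ ((n : ℝ) / 2) := by
      unfold mehlerKernel
      have e1 : Real.exp (-(‖y - Real.exp (-s) • x‖ ^ 2 / (1 - Real.exp (-s) ^ 2))) ≤ 1 := by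
        rw [Real.exp_le_one_iff, neg_nonpos]
        positivity
      calc _ ≤ 1 / (1 - Real.exp (-s) ^ 2) ^ ((n : ℝ) / 2) := by gcongr
        _ ≤ 1 / (s / (1 + s)) ^ ((n : ℝ) / 2) := by
            have := hlow s hs
            gcongr
        _ = (1 + 1 / s) ^ ((n : ℝ) / 2) := by
            rw [one_div, ← Real.inv_rpow (by positivity)]
            congr 1
            field_simp
            ring
    unfold poissonIntegrand
    have hs32 : 1 / s ^ (3 / 2 : ℝ) = (1 + 1 / s) ^ (3 / 2 : ℝ) * (s + 1) ^ (-(3 / 2) : ℝ) := by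
      rw [Real.rpow_neg (by positivity), ← div_eq_mul_inv, ← Real.div_rpow (by positivity)
        (by positivity), one_div, ← Real.inv_rpow hs.le]
      congr 1
      field_simp
    calc _ ≤ t / s ^ (3 / 2 : ℝ) * Real.exp (-(t ^ 2 / (4 * s))) *
            (1 + 1 / s) ^ ((n : ℝ) / 2) := by gcongr
      _ = t * Real.exp (-(t ^ 2 / (4 * s))) * (1 + 1 / s) ^ ((n : ℝ) / 2) *
            (1 / s ^ (3 / 2 : ℝ)) := by ring
      _ = t * (Real.exp (-(t ^ 2 / (4 * s))) * (1 + 1 / s) ^ ((n : ℝ) / 2 + 3 / 2)) *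
            (s + 1) ^ (-(3 / 2) : ℝ) := by
          rw [hs32, Real.rpow_add (by positivity)]
          ring
      _ ≤ t * A * (s + 1) ^ (-(3 / 2) : ℝ) := by gcongr; exact hA s hs
  have hint : MeasureTheory.IntegrableOn (fun s : ℝ => t * A * (s + 1) ^ (-(3 / 2) : ℝ))
      (Set.Ioi 0) :=
    (integrableOn_add_rpow_Ioi_of_lt (by norm_num) (by norm_num)).const_mul _
  refine MeasureTheory.Integrable.mono' hint
    (hcont.aestronglyMeasurable measurableSet_Ioi) ?_
  exact MeasureTheory.ae_restrict_of_forall_mem measurableSet_Ioi hbound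

end

end OrnsteinUhlenbeck

namespace OrnsteinUhlenbeck

open MeasureTheory

noncomputable section

/-! ### Integrals of the majorants -/

/-! For `x ≠ 0` write `y_x = a x`. Pythagoras (`norm_sub_smul_sq`) gives `|y - e^{-s}x|² = (a -
e^{-s})²|x|² + |y_x'|²`, so the Mehler kernel concentrates where `e^{-s} = a`. There is such an `s >
0`, namely `σ = -log a`, exactly when `0 < a < 1`.

Away from `σ`, or when there is no `σ`, or when `|x| ≤ 1`, or when `a < 1/2` and `|y_x| ≤ 1`, the
integrand is dominated by `localMajorant` or `globalMajorant`, whose integrals are bounded by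
multiples of `K1` and `K3` (`exists_poissonIntegrand_le_majorants`).

Near `σ` the integrand is at most a Gaussian in `s` centred at `σ`, and its integral is height times
width. If `a ≥ 1/2`, then `s ~ σ ~ 1 - a`; the height is `t σ^{-(n+3)/2} exp(-(t² + |y_x'|²)/(6σ))`
and the width `√σ/|x|`, which produces `K2` (`exists_gaussian_le_K2`). If `a < 1/2` and `|y_x| > 1`,
then `σ = log(|x|/|y_x|)` is bounded below; the height is `t σ^{-3/2} exp(-t²/(6σ) - |y_x'|²)` and
the width `1/|y_x|`, which produces `K4` (`gaussian_le_K4`). Heights and widths are meant up to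
constants. -/

theorem integral_rpow_mul_exp_neg_div_Ioi {q A : ℝ} (hq : 0 < q) (hA : 0 < A) :
    ∫ s in Set.Ioi (0 : ℝ), s ^ (-q - 1) * Real.exp (-(A / s)) = A ^ (-q) * Real.Gamma q := by
  -- The substitution `u = 1/s` turns the integral into a Gamma integral.
  have h := integral_comp_rpow_Ioi (fun u : ℝ => u ^ (q - 1) * Real.exp (-(A * u)))
    (p := -1) (by norm_num)
  rw [Real.integral_rpow_mul_exp_neg_mul_Ioi hq hA, one_div, Real.inv_rpow hA.le,
    ← Real.rpow_neg hA.le] at h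
  rw [← h]
  refine setIntegral_congr_fun measurableSet_Ioi fun s hs => ?_
  have hs : 0 < s := hs
  simp only [smul_eq_mul]
  rw [← Real.rpow_mul hs.le, Real.rpow_neg_one, ← mul_assoc, abs_neg, abs_one, one_mul,
    ← Real.rpow_add hs, div_eq_mul_inv]
  congr 2
  ring

theorem integrableOn_rpow_mul_exp_neg_div_Ioi {q A : ℝ} (hq : 0 < q) (hA : 0 < A) :
    IntegrableOn (fun s : ℝ => s ^ (-q - 1) * Real.exp (-(A / s))) (Set.Ioi 0) := by
  -- A non-integrable function has integral `0` by convention, whereas the value computed above is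
  -- positive.
  by_contra h
  have h0 := integral_rpow_mul_exp_neg_div_Ioi hq hA
  rw [integral_undef h] at h0
  have : 0 < A ^ (-q) * Real.Gamma q :=
    mul_pos (Real.rpow_pos_of_pos hA _) (Real.Gamma_pos_of_pos hq)
  linarith

/-- The majorant of the subordination integrand whose integral is comparable to `K1`. -/
def localMajorant {n : ℕ} (c t : ℝ) (x y : Rn n) (s : ℝ) : ℝ :=
  t * (s ^ (-(((n : ℝ) + 1) / 2) - 1) * Real.exp (-(c * (t ^ 2 + ‖x - y‖ ^ 2) / s)))
    * expStar c (t * (1 + ‖x‖))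

/-- The majorant of the subordination integrand whose integral is controlled by `K3`. -/
def globalMajorant {n : ℕ} (c t : ℝ) (y : Rn n) (s : ℝ) : ℝ :=
  t * (Real.exp (-(t ^ 2 / (4 * s))) * (s + 1) ^ (-(3 / 2) : ℝ)) * expStar c (‖y‖ ^ 2)

theorem expStar_pos (c X : ℝ) : 0 < expStar c X := Real.exp_pos _

theorem localMajorant_nonneg {n : ℕ} {c t : ℝ} (ht : 0 < t) (x y : Rn n) {s : ℝ} (hs : 0 < s) :
    0 ≤ localMajorant c t x y s := by
  have := expStar_pos c (t * (1 + ‖x‖))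
  unfold localMajorant
  positivity

theorem globalMajorant_nonneg {n : ℕ} {c t : ℝ} (ht : 0 < t) (y : Rn n) {s : ℝ} (hs : 0 < s) :
    0 ≤ globalMajorant c t y s := by
  have := expStar_pos c (‖y‖ ^ 2)
  unfold globalMajorant
  positivity

theorem integrableOn_localMajorant {n : ℕ} {c t : ℝ} (hc : 0 < c) (ht : 0 < t) (x y : Rn n) :
    IntegrableOn (localMajorant c t x y) (Set.Ioi 0) :=
  ((integrableOn_rpow_mul_exp_neg_div_Ioi (by positivity) (by positivity)).const_mul _).mul_const _

theorem integral_localMajorant {n : ℕ} {c t : ℝ} (hc : 0 < c) (ht : 0 < t) (x y : Rn n) :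
    ∫ s in Set.Ioi (0 : ℝ), localMajorant c t x y s =
      c ^ (-(((n : ℝ) + 1) / 2)) * Real.Gamma (((n : ℝ) + 1) / 2) * K1 c t x y := by
  have hA : 0 < t ^ 2 + ‖x - y‖ ^ 2 := by positivity
  unfold localMajorant K1
  rw [integral_mul_const, integral_const_mul,
    integral_rpow_mul_exp_neg_div_Ioi (by positivity) (by positivity),
    Real.mul_rpow hc.le hA.le, Real.rpow_neg hA.le]
  ring

theorem integrableOn_add_one_rpow :
    IntegrableOn (fun s : ℝ => (s + 1) ^ (-(3 / 2) : ℝ)) (Set.Ioi 0) :=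
  integrableOn_add_rpow_Ioi_of_lt (by norm_num) (by norm_num)

theorem integrableOn_exp_mul_add_one_rpow (t : ℝ) :
    IntegrableOn (fun s : ℝ => Real.exp (-(t ^ 2 / (4 * s))) * (s + 1) ^ (-(3 / 2) : ℝ))
      (Set.Ioi 0) := by
  refine Integrable.mono' integrableOn_add_one_rpow ?_ ?_
  · exact (by fun_prop : Measurable fun s : ℝ =>
      Real.exp (-(t ^ 2 / (4 * s))) * (s + 1) ^ (-(3 / 2) : ℝ)).aestronglyMeasurable
  · refine ae_restrict_of_forall_mem measurableSet_Ioi fun s hs => ?_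
    have hs : 0 < s := hs
    rw [Real.norm_of_nonneg (by positivity)]
    refine mul_le_of_le_one_left (by positivity) (Real.exp_le_one_iff.2 ?_)
    rw [neg_nonpos]
    positivity

theorem integrableOn_globalMajorant {n : ℕ} (c t : ℝ) (y : Rn n) :
    IntegrableOn (globalMajorant c t y) (Set.Ioi 0) :=
  ((integrableOn_exp_mul_add_one_rpow t).const_mul _).mul_const _

/-- Dropping the exponential gives a bound linear in `t`; replacing `(s + 1)^(-3/2)` by `s^(-3/2)`
gives a Gamma integral of size `1/t`, hence a bound uniform in `t`. Together they give `min 1 t`. -/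
theorem exists_integral_globalMajorant_le : ∃ C > (0 : ℝ), ∀ (n : ℕ) (c t : ℝ) (y : Rn n), 0 < t →
    ∫ s in Set.Ioi (0 : ℝ), globalMajorant c t y s ≤ C * K3 c t y := by
  set I := ∫ s in Set.Ioi (0 : ℝ), (s + 1) ^ (-(3 / 2) : ℝ) with hI
  have hI0 : 0 ≤ I := setIntegral_nonneg measurableSet_Ioi fun s hs => by
    have hs : 0 < s := hs
    positivity
  have hG := Real.Gamma_pos_of_pos (s := 1 / 2) (by norm_num)
  refine ⟨I + 2 * Real.Gamma (1 / 2), by positivity, fun n c t y ht => ?_⟩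
  unfold globalMajorant K3
  rw [integral_mul_const, integral_const_mul, ← mul_assoc]
  refine mul_le_mul_of_nonneg_right ?_ (expStar_pos _ _).le
  set J := ∫ s in Set.Ioi (0 : ℝ), Real.exp (-(t ^ 2 / (4 * s))) * (s + 1) ^ (-(3 / 2) : ℝ)
    with hJ
  have h1 : J ≤ I := by
    refine setIntegral_mono_on (integrableOn_exp_mul_add_one_rpow t) integrableOn_add_one_rpow
      measurableSet_Ioi fun s hs => ?_
    have hs : 0 < s := hs
    refine mul_le_of_le_one_left (by positivity) (Real.exp_le_one_iff.2 ?_)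
    rw [neg_nonpos]
    positivity
  have h2 : t * J ≤ 2 * Real.Gamma (1 / 2) := by
    have ht4 : 0 < t ^ 2 / 4 := by positivity
    have h3 : J ≤ ∫ s in Set.Ioi (0 : ℝ), s ^ (-(1 / 2) - 1 : ℝ) * Real.exp (-(t ^ 2 / 4 / s)) := by
      refine setIntegral_mono_on (integrableOn_exp_mul_add_one_rpow t)
        (integrableOn_rpow_mul_exp_neg_div_Ioi (by norm_num) ht4) measurableSet_Ioi fun s hs => ?_
      have hs : 0 < s := hs
      rw [mul_comm, div_div]
      refine mul_le_mul_of_nonneg_right ?_ (Real.exp_pos _).le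
      rw [show (-(1 / 2) - 1 : ℝ) = -(3 / 2) by norm_num]
      exact Real.rpow_le_rpow_of_nonpos hs (by linarith) (by norm_num)
    rw [integral_rpow_mul_exp_neg_div_Ioi (by norm_num) ht4] at h3
    have h4 : (t ^ 2 / 4) ^ (-(1 / 2) : ℝ) = 2 / t := by
      rw [Real.rpow_neg ht4.le, ← Real.sqrt_eq_rpow,
        show t ^ 2 / 4 = (t / 2) ^ 2 by ring, Real.sqrt_sq (by positivity), inv_div]
    rw [h4] at h3
    calc t * J ≤ t * (2 / t * Real.Gamma (1 / 2)) := by gcongr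
      _ = _ := by field_simp
  have h5 : t * J ≤ t * I := by gcongr
  rcases le_total 1 t with h | h
  · rw [min_eq_left h]
    linarith
  · rw [min_eq_right h]
    nlinarith

theorem integrableOn_gaussian {A b : ℝ} (hb : 0 < b) (σ : ℝ) :
    IntegrableOn (fun s : ℝ => A * Real.exp (-b * (s - σ) ^ 2)) (Set.Ioi 0) :=
  (((integrable_exp_neg_mul_sq hb).comp_sub_right σ).const_mul A).integrableOn

theorem setIntegral_gaussian_le {A b : ℝ} (hA : 0 ≤ A) (hb : 0 < b) (σ : ℝ) :
    ∫ s in Set.Ioi (0 : ℝ), A * Real.exp (-b * (s - σ) ^ 2) ≤ A * √(Real.pi / b) := by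
  refine (setIntegral_le_integral (((integrable_exp_neg_mul_sq hb).comp_sub_right σ).const_mul A)
    (ae_of_all _ fun s => by positivity)).trans_eq ?_
  rw [integral_const_mul, integral_sub_right_eq_self (fun s : ℝ => Real.exp (-b * s ^ 2)) σ,
    integral_gaussian]

/-! ### Bounds for the Mehler kernel -/

theorem exp_neg_le_inv_one_add {s : ℝ} (hs : 0 < s) : Real.exp (-s) ≤ 1 / (1 + s) := by
  rw [Real.exp_neg, ← one_div]
  exact one_div_le_one_div_of_le (by positivity) (by linarith [Real.add_one_le_exp s])

theorem div_one_add_le_one_sub_exp {s : ℝ} (hs : 0 < s) : s / (1 + s) ≤ 1 - Real.exp (-s) := by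
  have h3 : s / (1 + s) = 1 - 1 / (1 + s) := by field_simp; ring
  linarith [exp_neg_le_inv_one_add hs]

theorem div_one_add_le_one_sub_exp_sq {s : ℝ} (hs : 0 < s) :
    s / (1 + s) ≤ 1 - Real.exp (-s) ^ 2 := by
  have h2 : Real.exp (-s) ≤ 1 := Real.exp_le_one_iff.2 (by linarith)
  have h0 := Real.exp_pos (-s)
  nlinarith [div_one_add_le_one_sub_exp hs]

theorem one_sub_exp_sq_le (s : ℝ) : 1 - Real.exp (-s) ^ 2 ≤ 2 * s := by
  rw [← Real.exp_nat_mul]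
  have := Real.add_one_le_exp (2 * -s)
  push_cast
  linarith

/-- For `s ≤ 2` one has `s/3 ≤ 1 - e^{-2s} ≤ 2s`. The companion bound for `s ≥ 1/4` rests on `1/5 ≤
1 - e^{-2s} ≤ 1`. The two ranges overlap on `[1/4, 2]`, which leaves room to choose where to split.
-/
theorem mehlerKernel_exp_le_of_le_two {n : ℕ} (x y : Rn n) {s : ℝ} (hs : 0 < s) (hs2 : s ≤ 2) :
    mehlerKernel (Real.exp (-s)) x y ≤ 3 ^ ((n : ℝ) / 2) * s ^ (-((n : ℝ) / 2)) *
      Real.exp (-(‖y - Real.exp (-s) • x‖ ^ 2 / (2 * s))) := by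
  have h1 := div_one_add_le_one_sub_exp_sq hs
  have h2 : s / 3 ≤ 1 - Real.exp (-s) ^ 2 := le_trans (by gcongr; linarith) h1
  have h3 : 0 < 1 - Real.exp (-s) ^ 2 := lt_of_lt_of_le (by positivity) h2
  unfold mehlerKernel
  calc _ ≤ Real.exp (-(‖y - Real.exp (-s) • x‖ ^ 2 / (2 * s))) / (s / 3) ^ ((n : ℝ) / 2) := by
        have := one_sub_exp_sq_le s
        gcongr
    _ = _ := by
        rw [Real.div_rpow hs.le (by norm_num), Real.rpow_neg hs.le]
        field_simp

theorem mehlerKernel_exp_le_of_le {n : ℕ} (x y : Rn n) {s : ℝ} (hs : 1 / 4 ≤ s) :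
    mehlerKernel (Real.exp (-s)) x y ≤ 5 ^ ((n : ℝ) / 2) *
      Real.exp (-(‖y - Real.exp (-s) • x‖ ^ 2)) := by
  have hs0 : 0 < s := by linarith
  have h1 := div_one_add_le_one_sub_exp_sq hs0
  have h2 : 1 / 5 ≤ 1 - Real.exp (-s) ^ 2 := by
    refine le_trans ?_ h1
    rw [div_le_div_iff₀ (by norm_num) (by linarith)]
    linarith
  have h3 : 0 < 1 - Real.exp (-s) ^ 2 := by linarith
  have h4 : 1 - Real.exp (-s) ^ 2 ≤ 1 := by nlinarith [Real.exp_pos (-s)]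
  unfold mehlerKernel
  calc _ ≤ Real.exp (-(‖y - Real.exp (-s) • x‖ ^ 2)) / (1 / 5) ^ ((n : ℝ) / 2) := by
        gcongr
        exact le_div_self (by positivity) h3 h4
    _ = _ := by
        rw [Real.div_rpow (by norm_num) (by norm_num), Real.one_rpow]
        field_simp

/-! ### Pointwise domination of the integrand -/

theorem poissonIntegrand_le_of_le_two {n : ℕ} {t : ℝ} (ht : 0 < t) (x y : Rn n) {s : ℝ}
    (hs : 0 < s) (hs2 : s ≤ 2) :
    poissonIntegrand t x y s ≤ 3 ^ ((n : ℝ) / 2) * t * s ^ (-(((n : ℝ) + 1) / 2) - 1) *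
      Real.exp (-(t ^ 2 / (4 * s) + ‖y - Real.exp (-s) • x‖ ^ 2 / (2 * s))) := by
  unfold poissonIntegrand
  calc _ ≤ t / s ^ (3 / 2 : ℝ) * Real.exp (-(t ^ 2 / (4 * s))) *
        (3 ^ ((n : ℝ) / 2) * s ^ (-((n : ℝ) / 2)) *
          Real.exp (-(‖y - Real.exp (-s) • x‖ ^ 2 / (2 * s)))) := by
        have := mehlerKernel_exp_le_of_le_two x y hs hs2
        gcongr
    _ = _ := by
        rw [show (-(((n : ℝ) + 1) / 2) - 1) = -(3 / 2) + -((n : ℝ) / 2) by ring,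
          Real.rpow_add hs, neg_add, Real.exp_add, Real.rpow_neg hs.le (3 / 2)]
        ring

theorem poissonIntegrand_le_of_le {n : ℕ} {t : ℝ} (ht : 0 < t) (x y : Rn n) {s : ℝ}
    (hs : 1 / 4 ≤ s) :
    poissonIntegrand t x y s ≤ 5 ^ ((n : ℝ) / 2) * t * s ^ (-(3 / 2) : ℝ) *
      Real.exp (-(t ^ 2 / (4 * s) + ‖y - Real.exp (-s) • x‖ ^ 2)) := by
  have hs0 : 0 < s := by linarith
  unfold poissonIntegrand
  calc _ ≤ t / s ^ (3 / 2 : ℝ) * Real.exp (-(t ^ 2 / (4 * s))) *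
        (5 ^ ((n : ℝ) / 2) * Real.exp (-(‖y - Real.exp (-s) • x‖ ^ 2))) := by
        have := mehlerKernel_exp_le_of_le x y hs
        gcongr
    _ = _ := by
        rw [neg_add, Real.exp_add, Real.rpow_neg hs0.le (3 / 2)]
        ring

/-- The term `s²|x|²` yields the decay in `t|x|`: after division by `s`, the arithmetic-geometric
mean inequality bounds `t|x|` by `(t²/s + s|x|²)/2`. The slack `4 * s` contributes only a bounded
amount to the exponent, which goes into the factor `e³` together with the loss from `t ≤ t²/(2s) +
s`. -/
theorem poissonIntegrand_le_localMajorant {n : ℕ} {c t : ℝ} (hc : 0 < c) (hc1 : c ≤ 1 / 20)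
    (ht : 0 < t) (x y : Rn n) {s : ℝ} (hs : 0 < s) (hs2 : s ≤ 2)
    (h : 4 * c * (‖x - y‖ ^ 2 + s ^ 2 * ‖x‖ ^ 2) ≤ ‖y - Real.exp (-s) • x‖ ^ 2 + 4 * s) :
    poissonIntegrand t x y s ≤
      3 ^ ((n : ℝ) / 2) * Real.exp 3 * localMajorant c t x y s := by
  set X := ‖x‖
  set Q := ‖x - y‖ ^ 2
  set D := ‖y - Real.exp (-s) • x‖ ^ 2
  have hX : 0 ≤ X := norm_nonneg x
  have hQ : 0 ≤ Q := sq_nonneg _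
  have key : c * (t ^ 2 + Q) / s + c * (t * (1 + X)) - 3 ≤ t ^ 2 / (4 * s) + D / (2 * s) := by
    have e : t ^ 2 / (4 * s) + D / (2 * s) - (c * (t ^ 2 + Q) / s + c * (t * (1 + X)) - 3) =
        (t ^ 2 / 4 + D / 2 - c * (t ^ 2 + Q) - c * (t * (1 + X)) * s + 3 * s) / s := by
      field_simp
      ring
    have : 0 ≤ (t ^ 2 / 4 + D / 2 - c * (t ^ 2 + Q) - c * (t * (1 + X)) * s + 3 * s) / s := by
      refine div_nonneg ?_ hs.le
      have h1 : c * (t * s * X) ≤ c * ((t ^ 2 + s ^ 2 * X ^ 2) / 2) := by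
        gcongr
        nlinarith [sq_nonneg (t - s * X)]
      have h2 : c * (t * s) ≤ c * (t ^ 2 / 2 + s) := by
        gcongr
        nlinarith [sq_nonneg (t - s)]
      have h3 : c * t ^ 2 ≤ 1 / 20 * t ^ 2 := by gcongr
      have h4 : c * s ≤ 1 / 20 * s := by gcongr
      have h5 : 0 ≤ c * (s ^ 2 * X ^ 2) := by positivity
      have h6 : 0 ≤ c * Q := by positivity
      nlinarith
    linarith
  refine (poissonIntegrand_le_of_le_two ht x y hs hs2).trans ?_
  unfold localMajorant expStar
  calc _ ≤ 3 ^ ((n : ℝ) / 2) * t * s ^ (-(((n : ℝ) + 1) / 2) - 1) *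
      Real.exp (3 + -(c * (t ^ 2 + Q) / s) + -(c * (t * (1 + X)))) := by
        gcongr
        linarith
    _ = _ := by
        rw [Real.exp_add, Real.exp_add]
        ring

theorem poissonIntegrand_le_globalMajorant {n : ℕ} {c t : ℝ} (ht : 0 < t) (x y : Rn n) {s : ℝ}
    (hs : 1 / 4 ≤ s) (h : c * ‖y‖ ^ 2 ≤ ‖y - Real.exp (-s) • x‖ ^ 2 + 1) :
    poissonIntegrand t x y s ≤
      5 ^ ((n : ℝ) / 2) * 5 ^ (3 / 2 : ℝ) * Real.exp 1 * globalMajorant c t y s := by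
  have hs0 : 0 < s := by linarith
  refine (poissonIntegrand_le_of_le ht x y hs).trans ?_
  have h1 : s ^ (-(3 / 2) : ℝ) ≤ 5 ^ (3 / 2 : ℝ) * (s + 1) ^ (-(3 / 2) : ℝ) := by
    calc s ^ (-(3 / 2) : ℝ) ≤ (5⁻¹ * (s + 1)) ^ (-(3 / 2) : ℝ) :=
          Real.rpow_le_rpow_of_nonpos (by positivity) (by linarith) (by norm_num)
      _ = _ := by
          rw [Real.mul_rpow (by norm_num) (by positivity), Real.inv_rpow (by norm_num),
            ← Real.rpow_neg (by norm_num), neg_neg]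
  unfold globalMajorant expStar
  calc _ ≤ 5 ^ ((n : ℝ) / 2) * t * (5 ^ (3 / 2 : ℝ) * (s + 1) ^ (-(3 / 2) : ℝ)) *
      Real.exp (-(t ^ 2 / (4 * s)) + 1 + -(c * ‖y‖ ^ 2)) := by
        gcongr
        linarith
    _ = _ := by
        rw [Real.exp_add, Real.exp_add]
        ring

theorem exists_one_add_rpow_le_mul_exp (q : ℝ) {ε : ℝ} (hε : 0 < ε) :
    ∃ C > (0 : ℝ), ∀ z : ℝ, 0 ≤ z → (1 + z) ^ q ≤ C * Real.exp (ε * z) := by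
  obtain ⟨m, hm⟩ := exists_nat_ge q
  refine ⟨m.factorial * Real.exp ε / ε ^ m, by positivity, fun z hz => ?_⟩
  have h := Real.pow_div_factorial_le_exp (ε * (1 + z)) (by positivity) m
  rw [div_le_iff₀ (by positivity), mul_pow] at h
  calc (1 + z) ^ q ≤ (1 + z) ^ (m : ℝ) :=
        Real.rpow_le_rpow_of_exponent_le (by linarith) hm
    _ = (ε ^ m * (1 + z) ^ m) / ε ^ m := by
        rw [Real.rpow_natCast]
        field_simp
    _ ≤ (Real.exp (ε * (1 + z)) * m.factorial) / ε ^ m := by gcongr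
    _ = _ := by
        rw [mul_add, mul_one, Real.exp_add]
        ring

/-- Here `D = |y - e^{-s}x|²` is bounded below even as `s → 0`. The part `1/32` of it makes
`exp(-D/(2s))` contain `exp(-1/(64 s))`, which beats the singular power of `s`; the part `|y|²/8`
supplies the decay in `y`, since `s ≤ 1/4`. -/
theorem exists_poissonIntegrand_le_globalMajorant_of_le (n : ℕ) :
    ∃ C > (0 : ℝ), ∀ (c t : ℝ) (x y : Rn n) (s : ℝ), c ≤ 1 / 4 → 0 < t → 0 < s → s ≤ 1 / 4 →
      ‖y‖ ^ 2 / 8 + 1 / 32 ≤ ‖y - Real.exp (-s) • x‖ ^ 2 →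
      poissonIntegrand t x y s ≤ C * globalMajorant c t y s := by
  obtain ⟨C, hC, hbd⟩ := exists_one_add_rpow_le_mul_exp (((n : ℝ) + 1) / 2 + 1)
    (ε := 1 / 64) (by norm_num)
  refine ⟨3 ^ ((n : ℝ) / 2) * C * 2 ^ (3 / 2 : ℝ), by positivity, ?_⟩
  intro c t x y s hc ht hs hs4 h
  refine (poissonIntegrand_le_of_le_two ht x y hs (by linarith)).trans ?_
  have h1 : s ^ (-(((n : ℝ) + 1) / 2) - 1) ≤ C * Real.exp (1 / 64 * (1 / s)) := by
    refine le_trans ?_ (hbd (1 / s) (by positivity))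
    rw [show -(((n : ℝ) + 1) / 2) - 1 = -(((n : ℝ) + 1) / 2 + 1) by ring, Real.rpow_neg hs.le,
      ← Real.inv_rpow hs.le, ← one_div]
    exact Real.rpow_le_rpow (by positivity) (by linarith) (by positivity)
  have h2 : 1 ≤ 2 ^ (3 / 2 : ℝ) * (s + 1) ^ (-(3 / 2) : ℝ) := by
    rw [Real.rpow_neg (by positivity), ← div_eq_mul_inv, one_le_div (by positivity)]
    exact Real.rpow_le_rpow (by positivity) (by linarith) (by norm_num)
  have h3 : c * ‖y‖ ^ 2 + 1 / 64 * (1 / s) ≤ ‖y - Real.exp (-s) • x‖ ^ 2 / (2 * s) := by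
    have h4 : c * ‖y‖ ^ 2 ≤ 1 / 4 * ‖y‖ ^ 2 := by gcongr
    have h5 : ‖y‖ ^ 2 * s ≤ ‖y‖ ^ 2 * (1 / 4) := by gcongr
    have h6 : (c * ‖y‖ ^ 2) * s ≤ (1 / 4 * ‖y‖ ^ 2) * s := by gcongr
    rw [le_div_iff₀ (by positivity)]
    have e : (c * ‖y‖ ^ 2 + 1 / 64 * (1 / s)) * (2 * s) = 2 * ((c * ‖y‖ ^ 2) * s) + 1 / 32 := by
      field_simp
      ring
    linarith
  unfold globalMajorant expStar
  calc _ ≤ 3 ^ ((n : ℝ) / 2) * t * (C * Real.exp (1 / 64 * (1 / s))) *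
      Real.exp (-(t ^ 2 / (4 * s)) + -(c * ‖y‖ ^ 2) + -(1 / 64 * (1 / s))) := by
        gcongr
        linarith
    _ = 3 ^ ((n : ℝ) / 2) * t * C * Real.exp (-(t ^ 2 / (4 * s))) * Real.exp (-(c * ‖y‖ ^ 2)) *
        1 := by
        rw [Real.exp_add, Real.exp_add, Real.exp_neg (1 / 64 * (1 / s))]
        field_simp
    _ ≤ 3 ^ ((n : ℝ) / 2) * t * C * Real.exp (-(t ^ 2 / (4 * s))) * Real.exp (-(c * ‖y‖ ^ 2)) *
        (2 ^ (3 / 2 : ℝ) * (s + 1) ^ (-(3 / 2) : ℝ)) := by gcongr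
    _ = _ := by ring

/-! ### The component parallel to `x` -/

theorem par_eq_smul {n : ℕ} {x : Rn n} (hx : x ≠ 0) (y : Rn n) :
    par x y = (inner ℝ x y / ‖x‖ ^ 2) • x := by
  rw [par, if_neg hx, Submodule.starProjection_singleton]
  rfl

theorem norm_sub_smul_sq {n : ℕ} {x y : Rn n} {a : ℝ} (hx : x ≠ 0)
    (ha : inner ℝ x y / ‖x‖ ^ 2 = a) (r : ℝ) :
    ‖y - r • x‖ ^ 2 = (a - r) ^ 2 * ‖x‖ ^ 2 + ‖perp x y‖ ^ 2 := by
  have hX : ‖x‖ ^ 2 ≠ 0 := by simpa using hx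
  have h0 : inner ℝ ((a - r) • x) (perp x y) = 0 := by
    rw [perp, par_eq_smul hx, ha, inner_smul_left, inner_sub_right, inner_smul_right,
      real_inner_self_eq_norm_sq, ← ha, div_mul_cancel₀ _ hX, sub_self, mul_zero]
  have e : y - r • x = (a - r) • x + perp x y := by
    rw [perp, par_eq_smul hx, ha, sub_smul]
    abel
  rw [e, norm_add_sq_real, h0, norm_smul, mul_pow, Real.norm_eq_abs, sq_abs]
  ring

theorem norm_sq_eq {n : ℕ} {x y : Rn n} {a : ℝ} (hx : x ≠ 0)
    (ha : inner ℝ x y / ‖x‖ ^ 2 = a) :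
    ‖y‖ ^ 2 = a ^ 2 * ‖x‖ ^ 2 + ‖perp x y‖ ^ 2 := by
  simpa using norm_sub_smul_sq hx ha 0

theorem norm_sub_sq_eq {n : ℕ} {x y : Rn n} {a : ℝ} (hx : x ≠ 0)
    (ha : inner ℝ x y / ‖x‖ ^ 2 = a) :
    ‖x - y‖ ^ 2 = (1 - a) ^ 2 * ‖x‖ ^ 2 + ‖perp x y‖ ^ 2 := by
  have := norm_sub_smul_sq hx ha 1
  rw [one_smul, norm_sub_rev] at this
  rw [this]
  ring

/-! ### Bounds for `e^{-s} - e^{-σ}` -/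

/-- Mean value estimate: `m` bounds `e^{-u}` from below at both endpoints, hence between them. -/
theorem mul_abs_sub_le_abs_exp_sub {m s σ : ℝ} (hs : m ≤ Real.exp (-s))
    (hσ : m ≤ Real.exp (-σ)) : m * |s - σ| ≤ |Real.exp (-σ) - Real.exp (-s)| := by
  have key : ∀ u v : ℝ, m ≤ Real.exp (-v) → u ≤ v →
      m * (v - u) ≤ Real.exp (-u) - Real.exp (-v) := by
    intro u v hv huv
    have h1 := Real.add_one_le_exp (v - u)
    have h2 : Real.exp (-u) = Real.exp (-v) * Real.exp (v - u) := by
      rw [← Real.exp_add]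
      congr 1
      ring
    have h3 : m * (v - u) ≤ Real.exp (-v) * (v - u) :=
      mul_le_mul_of_nonneg_right hv (by linarith)
    have h4 : Real.exp (-v) * (v - u) ≤ Real.exp (-v) * (Real.exp (v - u) - 1) :=
      mul_le_mul_of_nonneg_left (by linarith) (Real.exp_pos _).le
    rw [h2]
    linarith
  rcases le_total s σ with h | h
  · rw [abs_sub_comm, abs_of_nonneg (sub_nonneg.2 h), abs_sub_comm]
    exact (key s σ hσ h).trans (le_abs_self _)
  · rw [abs_of_nonneg (sub_nonneg.2 h)]
    exact (key σ s hs h).trans (le_abs_self _)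

/-- The ratio `e^{σ - s}` is either at least `1 + 1/4` or at most `1/(1 + 1/4) = 4/5`. -/
theorem exp_neg_div_five_le_abs_exp_sub {s σ : ℝ} (h : 1 / 4 ≤ |s - σ|) :
    Real.exp (-σ) / 5 ≤ |Real.exp (-σ) - Real.exp (-s)| := by
  have h2 : Real.exp (-s) = Real.exp (-σ) * Real.exp (σ - s) := by
    rw [← Real.exp_add]
    congr 1
    ring
  have h0 := Real.exp_pos (-σ)
  rcases le_abs'.1 h with h | h
  · have h1 := Real.add_one_le_exp (σ - s)
    have : Real.exp (-σ) * (1 + 1 / 5) ≤ Real.exp (-s) := by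
      rw [h2]
      gcongr
      linarith
    rw [abs_sub_comm]
    exact le_trans (by linarith) (le_abs_self _)
  · have h1 := exp_neg_le_inv_one_add (s := s - σ) (by linarith)
    have h3 : 1 / (1 + (s - σ)) ≤ 4 / 5 := by
      rw [div_le_div_iff₀ (by linarith) (by norm_num)]
      linarith
    have : Real.exp (-s) ≤ Real.exp (-σ) * (4 / 5) := by
      rw [h2]
      gcongr
      rw [neg_sub] at h1
      linarith
    exact le_trans (by linarith) (le_abs_self _)

theorem one_eighth_le_exp_neg {s : ℝ} (hs : s ≤ 2) : 1 / 8 ≤ Real.exp (-s) := by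
  have h1 := Real.exp_one_lt_d9
  have h2 : Real.exp 2 ≤ 8 := by
    rw [show (2 : ℝ) = 1 + 1 by norm_num, Real.exp_add]
    nlinarith [Real.exp_pos 1]
  rw [Real.exp_neg, ← one_div]
  exact one_div_le_one_div_of_le (Real.exp_pos _) ((Real.exp_le_exp.2 hs).trans h2)

theorem exp_neg_le_quarter {s : ℝ} (hs : 2 ≤ s) : Real.exp (-s) ≤ 1 / 4 := by
  have h1 := Real.exp_one_gt_d9
  have h2 : 4 ≤ Real.exp 2 := by
    rw [show (2 : ℝ) = 1 + 1 by norm_num, Real.exp_add]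
    nlinarith
  rw [Real.exp_neg, ← one_div]
  exact one_div_le_one_div_of_le (by norm_num) (h2.trans (Real.exp_le_exp.2 hs))

/-! ### Integration of the pointwise bounds -/

theorem poissonIntegrand_nonneg {n : ℕ} {t : ℝ} (ht : 0 < t) (x y : Rn n) {s : ℝ} (hs : 0 < s) :
    0 ≤ poissonIntegrand t x y s := by
  have h1 : 0 < 1 - Real.exp (-s) ^ 2 :=
    lt_of_lt_of_le (by positivity) (div_one_add_le_one_sub_exp_sq hs)
  unfold poissonIntegrand mehlerKernel
  positivity

theorem K1_nonneg {n : ℕ} {c t : ℝ} (ht : 0 < t) (x y : Rn n) : 0 ≤ K1 c t x y := by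
  have := expStar_pos c (t * (1 + ‖x‖))
  unfold K1
  positivity

theorem K2_nonneg {n : ℕ} {c t : ℝ} (ht : 0 < t) (x y : Rn n) : 0 ≤ K2 c t x y := by
  refine Set.indicator_nonneg (fun z _ => ?_) y
  have := expStar_pos c ((t ^ 2 + ‖perp x z‖ ^ 2) * ‖x‖ / ‖x - par x z‖)
  positivity

theorem K3_nonneg {n : ℕ} {c t : ℝ} (ht : 0 < t) (y : Rn n) : 0 ≤ K3 c t y :=
  mul_nonneg (le_min zero_le_one ht.le) (expStar_pos _ _).le

theorem K4_nonneg {n : ℕ} {c t : ℝ} (ht : 0 < t) (x y : Rn n) : 0 ≤ K4 c t x y := by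
  refine Set.indicator_nonneg (fun z hz => ?_) y
  obtain ⟨-, h1, h2⟩ := hz
  have h3 : 0 < Real.log (‖x‖ / ‖par x z‖) := by
    refine Real.log_pos ?_
    rw [one_lt_div (by linarith)]
    linarith
  have := expStar_pos c (t ^ 2 / Real.log (‖x‖ / ‖par x z‖))
  have := expStar_pos c (‖perp x z‖ ^ 2)
  positivity

/-- The constant `C'` does not depend on `A`, `b`, `σ`, so the Gaussian can be adapted to `(x, y)`;
`A = 0` covers the regions without a peak. -/
theorem exists_poissonKernel_le_of_poissonIntegrand_le (n : ℕ) {c C : ℝ} (hc : 0 < c)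
    (hC : 0 < C) : ∃ C' > (0 : ℝ), ∀ (t : ℝ) (x y : Rn n) (A b σ : ℝ), 0 < t → 0 ≤ A → 0 < b →
      (∀ s, 0 < s → poissonIntegrand t x y s ≤ C * localMajorant c t x y s +
        C * globalMajorant c t y s + A * Real.exp (-b * (s - σ) ^ 2)) →
      poissonKernel t x y ≤ C' * (K1 c t x y + K3 c t y) + A * √(Real.pi / b) := by
  obtain ⟨C₃, hC₃, h3⟩ := exists_integral_globalMajorant_le
  set C₁ := c ^ (-(((n : ℝ) + 1) / 2)) * Real.Gamma (((n : ℝ) + 1) / 2) with hC₁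
  have hC₁0 : 0 < C₁ :=
    mul_pos (Real.rpow_pos_of_pos hc _) (Real.Gamma_pos_of_pos (by positivity))
  refine ⟨C * C₁ + C * C₃, by positivity, fun t x y A b σ ht hA hb h => ?_⟩
  have i1 := (integrableOn_localMajorant hc ht x y).const_mul C
  have i3 := (integrableOn_globalMajorant c t y).const_mul C
  have ig := integrableOn_gaussian (A := A) hb σ
  have hI : ∫ s in Set.Ioi (0 : ℝ), poissonIntegrand t x y s ≤
      C * C₁ * K1 c t x y + C * C₃ * K3 c t y + A * √(Real.pi / b) := by
    refine (setIntegral_mono_on (integrableOn_poissonIntegrand ht x y) ((i1.add i3).add ig)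
      measurableSet_Ioi fun s hs => h s hs).trans ?_
    have i13 : IntegrableOn (fun s => C * localMajorant c t x y s + C * globalMajorant c t y s)
      (Set.Ioi 0) := i1.add i3
    simp only [Pi.add_apply]
    rw [integral_add i13 ig, integral_add i1 i3, integral_const_mul, integral_const_mul,
      integral_localMajorant hc ht, mul_assoc C C₁, mul_assoc C C₃]
    have := h3 n c t y ht
    have := setIntegral_gaussian_le hA hb σ
    gcongr
  have hI0 : 0 ≤ ∫ s in Set.Ioi (0 : ℝ), poissonIntegrand t x y s :=
    setIntegral_nonneg measurableSet_Ioi fun s hs => poissonIntegrand_nonneg ht x y hs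
  have hpre : 1 / (2 * Real.pi ^ (((n : ℝ) + 1) / 2)) ≤ 1 := by
    rw [div_le_one (by positivity)]
    have := Real.one_le_rpow (x := Real.pi) (z := ((n : ℝ) + 1) / 2)
      (by linarith [Real.pi_gt_three]) (by positivity)
    linarith
  have k1 := K1_nonneg (c := c) ht x y
  have k3 := K3_nonneg (c := c) ht y
  unfold poissonKernel
  refine (mul_le_of_le_one_left hI0 hpre).trans (hI.trans ?_)
  have : 0 ≤ C * C₁ * K3 c t y := by positivity
  have : 0 ≤ C * C₃ * K1 c t x y := by positivity
  nlinarith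

/-! ### The regions of the `(x, y)` space -/

/-- The three alternatives are the hypotheses of the three domination lemmas. The local one requires
`4c = 1/2000`, whence `c = 1/8000`; the other two hold with room to spare. -/
theorem exists_poissonIntegrand_le_majorants (n : ℕ) :
    ∃ C > (0 : ℝ), ∀ (t : ℝ) (x y : Rn n) (s : ℝ), 0 < t → 0 < s →
      ((s ≤ 2 ∧ (‖x - y‖ ^ 2 + s ^ 2 * ‖x‖ ^ 2) / 2000 ≤
          ‖y - Real.exp (-s) • x‖ ^ 2 + 4 * s) ∨
        (1 / 4 ≤ s ∧ ‖y‖ ^ 2 / 50 ≤ ‖y - Real.exp (-s) • x‖ ^ 2 + 1) ∨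
        (s ≤ 1 / 4 ∧ ‖y‖ ^ 2 / 8 + 1 / 32 ≤ ‖y - Real.exp (-s) • x‖ ^ 2)) →
      poissonIntegrand t x y s ≤
        C * localMajorant (1 / 8000) t x y s + C * globalMajorant (1 / 8000) t y s := by
  obtain ⟨C₃, hC₃, h3⟩ := exists_poissonIntegrand_le_globalMajorant_of_le n
  set C₁ : ℝ := 3 ^ ((n : ℝ) / 2) * Real.exp 3
  set C₂ : ℝ := 5 ^ ((n : ℝ) / 2) * 5 ^ (3 / 2 : ℝ) * Real.exp 1
  have hC₁ : 0 < C₁ := by positivity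
  have hC₂ : 0 < C₂ := by positivity
  refine ⟨C₁ + C₂ + C₃, by positivity, fun t x y s ht hs h => ?_⟩
  have l0 := localMajorant_nonneg (c := 1 / 8000) ht x y hs
  have g0 := globalMajorant_nonneg (c := 1 / 8000) ht y hs
  have hl : C₁ * localMajorant (1 / 8000) t x y s ≤
      (C₁ + C₂ + C₃) * localMajorant (1 / 8000) t x y s := by
    gcongr
    linarith
  have hg2 : C₂ * globalMajorant (1 / 8000) t y s ≤
      (C₁ + C₂ + C₃) * globalMajorant (1 / 8000) t y s := by
    gcongr
    linarith
  have hg3 : C₃ * globalMajorant (1 / 8000) t y s ≤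
      (C₁ + C₂ + C₃) * globalMajorant (1 / 8000) t y s := by
    gcongr
    linarith
  have l0' := mul_nonneg hC₁.le l0
  have g0' := mul_nonneg hC₂.le g0
  rcases h with ⟨hs2, h⟩ | ⟨hs4, h⟩ | ⟨hs4, h⟩
  · have := poissonIntegrand_le_localMajorant (c := 1 / 8000) (by norm_num) (by norm_num) ht x y hs
      hs2 (by linarith)
    linarith
  · have := poissonIntegrand_le_globalMajorant (c := 1 / 8000) ht x y hs4
      (by linarith [sq_nonneg ‖y‖])
    linarith
  · have := h3 (1 / 8000) t x y s (by norm_num) ht hs hs4 h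
    linarith

theorem local_or_global_of_norm_le_one {n : ℕ} {x : Rn n} (hx : ‖x‖ ≤ 1) (y : Rn n) {s : ℝ}
    (hs : 0 < s) :
    (s ≤ 2 ∧ (‖x - y‖ ^ 2 + s ^ 2 * ‖x‖ ^ 2) / 2000 ≤ ‖y - Real.exp (-s) • x‖ ^ 2 + 4 * s) ∨
      (1 / 4 ≤ s ∧ ‖y‖ ^ 2 / 50 ≤ ‖y - Real.exp (-s) • x‖ ^ 2 + 1) := by
  have hr0 := Real.exp_pos (-s)
  have hr1 : Real.exp (-s) ≤ 1 := Real.exp_le_one_iff.2 (by linarith)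
  have hrs := Real.add_one_le_exp (-s)
  have hX := norm_nonneg x
  rcases le_total s 2 with h | h
  · left
    refine ⟨h, ?_⟩
    -- Replacing `e^{-s}x` by `x` costs at most `s`, because `|x| ≤ 1`; the resulting multiples of
    -- `s²` are absorbed by `4 * s`, as `s ≤ 2`.
    have h1 : ‖x - y‖ ≤ ‖y - Real.exp (-s) • x‖ + s := by
      have e : x - y = (1 - Real.exp (-s)) • x - (y - Real.exp (-s) • x) := by
        rw [sub_smul, one_smul]
        abel
      have h2 := norm_sub_le ((1 - Real.exp (-s)) • x) (y - Real.exp (-s) • x)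
      rw [← e, norm_smul, Real.norm_of_nonneg (by linarith)] at h2
      have : (1 - Real.exp (-s)) * ‖x‖ ≤ s * 1 := by
        gcongr
        linarith
      linarith
    have h3 : ‖x - y‖ ^ 2 ≤ 2 * ‖y - Real.exp (-s) • x‖ ^ 2 + 2 * s ^ 2 := by
      have : ‖x - y‖ ^ 2 ≤ (‖y - Real.exp (-s) • x‖ + s) ^ 2 := by gcongr
      nlinarith [sq_nonneg (‖y - Real.exp (-s) • x‖ - s)]
    have h4 : s ^ 2 * ‖x‖ ^ 2 ≤ s ^ 2 * 1 := by
      gcongr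
      nlinarith
    nlinarith [sq_nonneg ‖y - Real.exp (-s) • x‖]
  · right
    refine ⟨by linarith, ?_⟩
    have h1 : ‖y‖ ≤ ‖y - Real.exp (-s) • x‖ + 1 := by
      have h2 := norm_add_le (y - Real.exp (-s) • x) (Real.exp (-s) • x)
      rw [sub_add_cancel, norm_smul, Real.norm_of_nonneg hr0.le] at h2
      have : Real.exp (-s) * ‖x‖ ≤ 1 * 1 := by gcongr
      linarith
    have h3 : ‖y‖ ^ 2 ≤ (‖y - Real.exp (-s) • x‖ + 1) ^ 2 := by gcongr
    nlinarith [sq_nonneg (‖y - Real.exp (-s) • x‖ - 1)]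

/-- Reduction to a scalar inequality along `x`: the orthogonal part enters both sides, with the
larger coefficient on the right. -/
theorem local_of_le_sq {n : ℕ} {x y : Rn n} {a : ℝ} (hx : x ≠ 0)
    (ha : inner ℝ x y / ‖x‖ ^ 2 = a) {s : ℝ} (hs : 0 < s)
    (h : ((1 - a) ^ 2 + s ^ 2) / 2000 ≤ (a - Real.exp (-s)) ^ 2) :
    (‖x - y‖ ^ 2 + s ^ 2 * ‖x‖ ^ 2) / 2000 ≤ ‖y - Real.exp (-s) • x‖ ^ 2 + 4 * s := by
  rw [norm_sub_smul_sq hx ha, norm_sub_sq_eq hx ha]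
  have := mul_le_mul_of_nonneg_right h (sq_nonneg ‖x‖)
  nlinarith [sq_nonneg ‖perp x y‖]

theorem global_of_le_sq {n : ℕ} {x y : Rn n} {a : ℝ} (hx : x ≠ 0)
    (ha : inner ℝ x y / ‖x‖ ^ 2 = a) {s : ℝ}
    (h : a ^ 2 / 50 ≤ (a - Real.exp (-s)) ^ 2) :
    ‖y‖ ^ 2 / 50 ≤ ‖y - Real.exp (-s) • x‖ ^ 2 + 1 := by
  rw [norm_sub_smul_sq hx ha, norm_sq_eq hx ha]
  have := mul_le_mul_of_nonneg_right h (sq_nonneg ‖x‖)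
  nlinarith [sq_nonneg ‖perp x y‖]

theorem local_or_global_of_nonpos {n : ℕ} {x y : Rn n} {a : ℝ} (hx : x ≠ 0)
    (ha : inner ℝ x y / ‖x‖ ^ 2 = a) (ha0 : a ≤ 0) {s : ℝ} (hs : 0 < s) :
    (s ≤ 2 ∧ (‖x - y‖ ^ 2 + s ^ 2 * ‖x‖ ^ 2) / 2000 ≤ ‖y - Real.exp (-s) • x‖ ^ 2 + 4 * s) ∨
      (1 / 4 ≤ s ∧ ‖y‖ ^ 2 / 50 ≤ ‖y - Real.exp (-s) • x‖ ^ 2 + 1) := by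
  have hr0 := Real.exp_pos (-s)
  rcases le_total s 2 with h | h
  · refine Or.inl ⟨h, local_of_le_sq hx ha hs ?_⟩
    have h1 := one_eighth_le_exp_neg h
    have h2 : ((1 - a) / 8) ^ 2 ≤ (Real.exp (-s) - a) ^ 2 := by
      gcongr
      · linarith
      · linarith
    nlinarith
  · refine Or.inr ⟨by linarith, global_of_le_sq hx ha ?_⟩
    nlinarith

theorem local_or_global_of_one_le {n : ℕ} {x y : Rn n} {a : ℝ} (hx : x ≠ 0)
    (ha : inner ℝ x y / ‖x‖ ^ 2 = a) (ha1 : 1 ≤ a) {s : ℝ} (hs : 0 < s) :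
    (s ≤ 2 ∧ (‖x - y‖ ^ 2 + s ^ 2 * ‖x‖ ^ 2) / 2000 ≤ ‖y - Real.exp (-s) • x‖ ^ 2 + 4 * s) ∨
      (1 / 4 ≤ s ∧ ‖y‖ ^ 2 / 50 ≤ ‖y - Real.exp (-s) • x‖ ^ 2 + 1) := by
  have hr0 := Real.exp_pos (-s)
  rcases le_total s 2 with h | h
  · refine Or.inl ⟨h, local_of_le_sq hx ha hs ?_⟩
    have h1 := div_one_add_le_one_sub_exp hs
    have h2 : s / 3 ≤ s / (1 + s) := by gcongr; linarith
    have h3 : ((a - 1) + s / 3) ^ 2 ≤ (a - Real.exp (-s)) ^ 2 := by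
      gcongr
      linarith
    nlinarith
  · refine Or.inr ⟨by linarith, global_of_le_sq hx ha ?_⟩
    have h1 := exp_neg_le_quarter h
    nlinarith

theorem local_or_global_of_half_le {n : ℕ} {x y : Rn n} {a σ : ℝ} (hx : x ≠ 0)
    (ha : inner ℝ x y / ‖x‖ ^ 2 = a) (hσ : a = Real.exp (-σ)) (ha2 : 1 / 2 ≤ a) (hσ0 : 0 < σ)
    {s : ℝ} (hs : 0 < s) (h : σ / 2 ≤ |s - σ|) :
    (s ≤ 2 ∧ (‖x - y‖ ^ 2 + s ^ 2 * ‖x‖ ^ 2) / 2000 ≤ ‖y - Real.exp (-s) • x‖ ^ 2 + 4 * s) ∨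
      (1 / 4 ≤ s ∧ ‖y‖ ^ 2 / 50 ≤ ‖y - Real.exp (-s) • x‖ ^ 2 + 1) := by
  rcases le_total s 2 with hs2 | hs2
  · refine Or.inl ⟨hs2, local_of_le_sq hx ha hs ?_⟩
    have h1 := mul_abs_sub_le_abs_exp_sub (one_eighth_le_exp_neg hs2)
      (by linarith : 1 / 8 ≤ Real.exp (-σ))
    rw [← hσ] at h1
    have h2 : (1 / 8 * |s - σ|) ^ 2 ≤ |a - Real.exp (-s)| ^ 2 := by gcongr
    rw [sq_abs] at h2
    -- Since `σ ≤ 2|s - σ|`, both `s` and `1 - a ≤ σ` are controlled by the distance to the peak.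
    have h3 : s ≤ 3 * |s - σ| := by linarith [le_abs_self (s - σ)]
    have h4 : 1 - a ≤ 2 * |s - σ| := by
      rw [hσ]
      linarith [Real.add_one_le_exp (-σ)]
    have h5 : s ^ 2 ≤ (3 * |s - σ|) ^ 2 := by gcongr
    have h6 : (1 - a) ^ 2 ≤ (2 * |s - σ|) ^ 2 := by
      have : a ≤ 1 := hσ ▸ Real.exp_le_one_iff.2 (by linarith)
      gcongr
    nlinarith
  · refine Or.inr ⟨by linarith, global_of_le_sq hx ha ?_⟩
    have h1 := exp_neg_le_quarter hs2
    nlinarith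

/-! ### The peak for `1/2 ≤ a < 1`: the kernel `K2` -/

theorem poissonIntegrand_le_gaussian_of_half_le {n : ℕ} {t : ℝ} (ht : 0 < t) {x y : Rn n}
    {a σ : ℝ} (hx : x ≠ 0) (ha : inner ℝ x y / ‖x‖ ^ 2 = a) (hσ : a = Real.exp (-σ))
    (ha2 : 1 / 2 ≤ a) (hσ0 : 0 < σ) (hσ1 : σ ≤ 1) {s : ℝ} (h : |s - σ| ≤ σ / 2) :
    poissonIntegrand t x y s ≤ 3 ^ ((n : ℝ) / 2) * t * (σ / 2) ^ (-(((n : ℝ) + 1) / 2) - 1) *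
      Real.exp (-((t ^ 2 + ‖perp x y‖ ^ 2) / (6 * σ))) *
        Real.exp (-(‖x‖ ^ 2 / (192 * σ)) * (s - σ) ^ 2) := by
  obtain ⟨h1, h2⟩ := abs_le.1 h
  -- On this range `σ/2 ≤ s ≤ 3σ/2`, so `4s ≤ 6σ` and `2s ≤ 3σ`; the constant `192` is `64 · 3`,
  -- with `64` from the slope bound `1/8`.
  have hs2 : s ≤ 2 := by linarith
  have hs : 0 < s := by linarith
  refine (poissonIntegrand_le_of_le_two ht x y hs hs2).trans ?_
  rw [mul_assoc (_ * _) (Real.exp _), ← Real.exp_add]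
  have hD : (s - σ) ^ 2 / 64 * ‖x‖ ^ 2 + ‖perp x y‖ ^ 2 ≤ ‖y - Real.exp (-s) • x‖ ^ 2 := by
    rw [norm_sub_smul_sq hx ha]
    have h3 := mul_abs_sub_le_abs_exp_sub (one_eighth_le_exp_neg hs2)
      (by linarith : 1 / 8 ≤ Real.exp (-σ))
    rw [← hσ] at h3
    have h4 : (1 / 8 * |s - σ|) ^ 2 ≤ |a - Real.exp (-s)| ^ 2 := by gcongr
    rw [mul_pow, sq_abs, sq_abs] at h4
    gcongr
    linarith
  have hE : (t ^ 2 + ‖perp x y‖ ^ 2) / (6 * σ) + ‖x‖ ^ 2 / (192 * σ) * (s - σ) ^ 2 ≤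
      t ^ 2 / (4 * s) + ‖y - Real.exp (-s) • x‖ ^ 2 / (2 * s) := by
    have e1 : t ^ 2 / (6 * σ) ≤ t ^ 2 / (4 * s) := by
      exact div_le_div_of_nonneg_left (sq_nonneg _) (by linarith) (by linarith)
    have e2 : ((s - σ) ^ 2 / 64 * ‖x‖ ^ 2 + ‖perp x y‖ ^ 2) / (3 * σ) ≤
        ‖y - Real.exp (-s) • x‖ ^ 2 / (2 * s) := by
      gcongr ?_ / ?_
      linarith
    have e3 : ‖perp x y‖ ^ 2 / (6 * σ) ≤ ‖perp x y‖ ^ 2 / (3 * σ) := by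
      exact div_le_div_of_nonneg_left (sq_nonneg _) (by linarith) (by linarith)
    have e4 : (t ^ 2 + ‖perp x y‖ ^ 2) / (6 * σ) + ‖x‖ ^ 2 / (192 * σ) * (s - σ) ^ 2 =
        t ^ 2 / (6 * σ) + ((s - σ) ^ 2 / 64 * ‖x‖ ^ 2 + ‖perp x y‖ ^ 2) / (3 * σ) +
          (‖perp x y‖ ^ 2 / (6 * σ) - ‖perp x y‖ ^ 2 / (3 * σ)) := by
      field_simp
      ring
    linarith
  have hp : s ^ (-(((n : ℝ) + 1) / 2) - 1) ≤ (σ / 2) ^ (-(((n : ℝ) + 1) / 2) - 1) := by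
    refine Real.rpow_le_rpow_of_nonpos (by positivity) (by linarith) ?_
    have : (0 : ℝ) ≤ n := Nat.cast_nonneg n
    linarith
  gcongr
  linarith

theorem K2_eq {n : ℕ} {c t : ℝ} {x y : Rn n} {a : ℝ} (hx : 1 < ‖x‖)
    (ha : inner ℝ x y / ‖x‖ ^ 2 = a) (ha2 : 1 / 2 ≤ a) (ha1 : a < 1) :
    K2 c t x y = t / ‖x‖ * (t ^ 2 + (1 - a) + ‖perp x y‖ ^ 2) ^ (-(((n : ℝ) + 2) / 2)) *
      Real.exp (-(c * ((t ^ 2 + ‖perp x y‖ ^ 2) / (1 - a)))) := by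
  have hx0 : x ≠ 0 := norm_pos_iff.1 (by linarith)
  have hX : 0 < ‖x‖ := by linarith
  have hpar : par x y = a • x := by rw [par_eq_smul hx0, ha]
  have hn : ‖par x y‖ = a * ‖x‖ := by
    rw [hpar, norm_smul, Real.norm_of_nonneg (by linarith)]
  have hd : ‖x - par x y‖ = (1 - a) * ‖x‖ := by
    rw [hpar, ← Real.norm_of_nonneg (by linarith : 0 ≤ 1 - a), ← norm_smul, sub_smul, one_smul]
  have hi : inner ℝ x y = a * ‖x‖ ^ 2 := by rw [← ha]; field_simp
  have hmem : y ∈ {z : Rn n | 1 < ‖x‖ ∧ 0 < inner ℝ x z ∧ ‖x‖ / 2 ≤ ‖par x z‖ ∧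
      ‖par x z‖ < ‖x‖} := by
    refine ⟨hx, ?_, ?_, ?_⟩
    · rw [hi]; positivity
    · rw [hn]; nlinarith
    · rw [hn]; nlinarith
  have h1a : 0 < 1 - a := by linarith
  rw [K2, Set.indicator_of_mem hmem, hd, expStar, mul_div_cancel_right₀ _ hX.ne',
    mul_div_mul_right _ _ hX.ne']

theorem exists_gaussian_le_K2 (n : ℕ) :
    ∃ C > (0 : ℝ), ∀ (t : ℝ) (x y : Rn n) (a σ : ℝ), 0 < t → 1 < ‖x‖ →
      inner ℝ x y / ‖x‖ ^ 2 = a → a = Real.exp (-σ) → 1 / 2 ≤ a → 0 < σ → σ ≤ 1 →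
      3 ^ ((n : ℝ) / 2) * t * (σ / 2) ^ (-(((n : ℝ) + 1) / 2) - 1) *
        Real.exp (-((t ^ 2 + ‖perp x y‖ ^ 2) / (6 * σ))) *
          √(Real.pi / (‖x‖ ^ 2 / (192 * σ))) ≤ C * K2 (1 / 8000) t x y := by
  obtain ⟨C, hC, hbd⟩ := exists_one_add_rpow_le_mul_exp (((n : ℝ) + 2) / 2)
    (ε := 1 / 24) (by norm_num)
  refine ⟨3 ^ ((n : ℝ) / 2) * 2 ^ (((n : ℝ) + 1) / 2 + 1) * √(192 * Real.pi) * C,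
    by positivity, ?_⟩
  intro t x y a σ ht hx ha hσ ha2 hσ0 hσ1
  have hX : 0 < ‖x‖ := by linarith
  have hδσ : 1 - a ≤ σ := by rw [hσ]; linarith [Real.add_one_le_exp (-σ)]
  have hσδ : σ ≤ 2 * (1 - a) := by
    have h1 := div_one_add_le_one_sub_exp hσ0
    have h2 : σ / 2 ≤ σ / (1 + σ) := by gcongr; linarith
    rw [hσ]
    linarith
  have hδ : 0 < 1 - a := by linarith
  rw [K2_eq hx ha ha2 (by linarith)]
  set δ := 1 - a
  set W := t ^ 2 + ‖perp x y‖ ^ 2 with hW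
  have hW0 : 0 ≤ W := by positivity
  have hpow : (σ / 2) ^ (-(((n : ℝ) + 1) / 2) - 1) =
      2 ^ (((n : ℝ) + 1) / 2 + 1) * σ ^ (-(((n : ℝ) + 1) / 2) - 1) := by
    rw [Real.div_rpow hσ0.le (by norm_num), div_eq_mul_inv, ← Real.rpow_neg (by norm_num), mul_comm]
    congr 2
    ring
  have hsqrt : √(Real.pi / (‖x‖ ^ 2 / (192 * σ))) =
      √(192 * Real.pi) * (σ ^ (1 / 2 : ℝ) / ‖x‖) := by
    rw [show Real.pi / (‖x‖ ^ 2 / (192 * σ)) = 192 * Real.pi * σ / ‖x‖ ^ 2 by field_simp,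
      Real.sqrt_div (by positivity), Real.sqrt_sq hX.le, Real.sqrt_mul (by positivity) σ,
      ← Real.sqrt_eq_rpow, mul_div_assoc]
  have hcomb : σ ^ (-(((n : ℝ) + 1) / 2) - 1) * σ ^ (1 / 2 : ℝ) = σ ^ (-(((n : ℝ) + 2) / 2)) := by
    rw [← Real.rpow_add hσ0]
    congr 1
    ring
  have hq : σ ^ (-(((n : ℝ) + 2) / 2)) ≤ δ ^ (-(((n : ℝ) + 2) / 2)) := by
    refine Real.rpow_le_rpow_of_nonpos hδ hδσ ?_
    have : (0 : ℝ) ≤ n := Nat.cast_nonneg n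
    linarith
  -- Since `σ ≤ 2δ`, the exponent is at least `W/(12δ)`. Half of it is spent on the factor `(1 +
  -- W/δ)^(-(n+2)/2)`, which turns `δ^(-(n+2)/2)` into `(δ + W)^(-(n+2)/2)`; the other half covers
  -- the exponential in `K2`.
  have hexp : Real.exp (-(W / (6 * σ))) ≤ Real.exp (-(1 / 24 * (W / δ))) *
      Real.exp (-(1 / 8000 * (W / δ))) := by
    rw [← Real.exp_add]
    refine Real.exp_le_exp.2 ?_
    have h1 : W / (6 * (2 * δ)) ≤ W / (6 * σ) := by gcongr
    have h2 : W / (6 * (2 * δ)) = 1 / 12 * (W / δ) := by field_simp; ring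
    have h3 : 0 ≤ W / δ := by positivity
    linarith
  have hz : Real.exp (-(1 / 24 * (W / δ))) ≤ C * (1 + W / δ) ^ (-(((n : ℝ) + 2) / 2)) := by
    have := hbd (W / δ) (by positivity)
    rw [Real.rpow_neg (by positivity), ← div_eq_mul_inv, le_div_iff₀ (by positivity),
      Real.exp_neg, inv_mul_le_iff₀ (Real.exp_pos _)]
    linarith
  have hprod : δ ^ (-(((n : ℝ) + 2) / 2)) * (1 + W / δ) ^ (-(((n : ℝ) + 2) / 2)) =
      (t ^ 2 + δ + ‖perp x y‖ ^ 2) ^ (-(((n : ℝ) + 2) / 2)) := by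
    rw [← Real.mul_rpow hδ.le (by positivity)]
    congr 1
    rw [hW]
    field_simp
    ring
  rw [hpow, hsqrt]
  calc _ = 3 ^ ((n : ℝ) / 2) * 2 ^ (((n : ℝ) + 1) / 2 + 1) * √(192 * Real.pi) * (t / ‖x‖) *
        (σ ^ (-(((n : ℝ) + 1) / 2) - 1) * σ ^ (1 / 2 : ℝ)) * Real.exp (-(W / (6 * σ))) := by ring
    _ ≤ 3 ^ ((n : ℝ) / 2) * 2 ^ (((n : ℝ) + 1) / 2 + 1) * √(192 * Real.pi) * (t / ‖x‖) *
        δ ^ (-(((n : ℝ) + 2) / 2)) * ((C * (1 + W / δ) ^ (-(((n : ℝ) + 2) / 2))) *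
          Real.exp (-(1 / 8000 * (W / δ)))) := by
        rw [hcomb]
        gcongr
        exact hexp.trans (by gcongr)
    _ = _ := by
        rw [← hprod]
        ring

/-! ### The peak for `0 < a < 1/2`: the kernel `K4` -/

theorem cases_of_lt_half {n : ℕ} {x y : Rn n} {a σ : ℝ} (hx : 1 < ‖x‖)
    (ha : inner ℝ x y / ‖x‖ ^ 2 = a) (hσ : a = Real.exp (-σ)) (ha2 : a < 1 / 2)
    {s : ℝ} (h : a * ‖x‖ ≤ 1 ∨ 1 / 4 ≤ |s - σ|) :
    (1 / 4 ≤ s ∧ ‖y‖ ^ 2 / 50 ≤ ‖y - Real.exp (-s) • x‖ ^ 2 + 1) ∨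
      (s ≤ 1 / 4 ∧ ‖y‖ ^ 2 / 8 + 1 / 32 ≤ ‖y - Real.exp (-s) • x‖ ^ 2) := by
  have hx0 : x ≠ 0 := norm_pos_iff.1 (by linarith)
  have ha0 : 0 < a := hσ ▸ Real.exp_pos _
  rcases le_total s (1 / 4) with hs4 | hs4
  · refine Or.inr ⟨hs4, ?_⟩
    rw [norm_sub_smul_sq hx0 ha, norm_sq_eq hx0 ha]
    have hr := Real.add_one_le_exp (-s)
    -- As `e^{-s} ≥ 3/4` and `a < 1/2`, the parallel part is at least `|x|²/16`. Half of this covers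
    -- `a²|x|²/8`, the other half `1/32`, because `|x| > 1`.
    have h1 : (1 / 4) ^ 2 ≤ (Real.exp (-s) - a) ^ 2 := by
      gcongr
      linarith
    have h2 : 1 ≤ ‖x‖ ^ 2 := by nlinarith
    have h3 : a ^ 2 ≤ (1 / 2) ^ 2 := by gcongr
    nlinarith [sq_nonneg ‖perp x y‖]
  · refine Or.inl ⟨hs4, ?_⟩
    rcases h with h | h
    · rw [norm_sub_smul_sq hx0 ha, norm_sq_eq hx0 ha]
      have h1 : (a * ‖x‖) ^ 2 ≤ 1 ^ 2 := by gcongr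
      have h2 : 0 ≤ (a - Real.exp (-s)) ^ 2 * ‖x‖ ^ 2 := by positivity
      nlinarith [sq_nonneg ‖perp x y‖]
    · refine global_of_le_sq hx0 ha ?_
      have h1 := exp_neg_div_five_le_abs_exp_sub h
      rw [← hσ] at h1
      have h2 : (a / 5) ^ 2 ≤ |a - Real.exp (-s)| ^ 2 := by gcongr
      rw [sq_abs] at h2
      nlinarith

theorem poissonIntegrand_le_gaussian_of_lt_half {n : ℕ} {t : ℝ} (ht : 0 < t) {x y : Rn n}
    {a σ : ℝ} (hx : x ≠ 0) (ha : inner ℝ x y / ‖x‖ ^ 2 = a) (hσ : a = Real.exp (-σ))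
    (hσ1 : 1 / 2 ≤ σ) {s : ℝ} (h : |s - σ| ≤ 1 / 4) :
    poissonIntegrand t x y s ≤ 5 ^ ((n : ℝ) / 2) * t * (σ / 2) ^ (-(3 / 2) : ℝ) *
      Real.exp (-(t ^ 2 / (6 * σ) + ‖perp x y‖ ^ 2)) *
        Real.exp (-((a * ‖x‖) ^ 2 / 4) * (s - σ) ^ 2) := by
  obtain ⟨h1, h2⟩ := abs_le.1 h
  have hs4 : 1 / 4 ≤ s := by linarith
  have hs : 0 < s := by linarith
  refine (poissonIntegrand_le_of_le ht x y hs4).trans ?_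
  rw [mul_assoc (_ * _) (Real.exp _), ← Real.exp_add]
  have ha0 : 0 < a := hσ ▸ Real.exp_pos _
  have hD : a ^ 2 / 4 * (s - σ) ^ 2 * ‖x‖ ^ 2 + ‖perp x y‖ ^ 2 ≤
      ‖y - Real.exp (-s) • x‖ ^ 2 := by
    rw [norm_sub_smul_sq hx ha]
    -- Now `a` may be arbitrarily small, so the slope of `e^{-s}` near `σ` must be compared with `a`
    -- itself; this makes the width of the Gaussian `1/(a|x|) = 1/|y_x|`.
    have h5 : a / 2 ≤ Real.exp (-s) := by
      have e : Real.exp (-s) = a * Real.exp (σ - s) := by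
        rw [hσ, ← Real.exp_add]
        congr 1
        ring
      have := Real.add_one_le_exp (σ - s)
      rw [e, div_eq_mul_inv]
      gcongr
      linarith
    have h3 := mul_abs_sub_le_abs_exp_sub h5 (by linarith : a / 2 ≤ Real.exp (-σ))
    rw [← hσ] at h3
    have h4 : (a / 2 * |s - σ|) ^ 2 ≤ |a - Real.exp (-s)| ^ 2 := by gcongr
    rw [mul_pow, sq_abs, sq_abs] at h4
    gcongr
    linarith
  have hE : t ^ 2 / (6 * σ) + ‖perp x y‖ ^ 2 + (a * ‖x‖) ^ 2 / 4 * (s - σ) ^ 2 ≤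
      t ^ 2 / (4 * s) + ‖y - Real.exp (-s) • x‖ ^ 2 := by
    have e1 : t ^ 2 / (6 * σ) ≤ t ^ 2 / (4 * s) := by
      exact div_le_div_of_nonneg_left (sq_nonneg _) (by linarith) (by linarith)
    linarith
  have hp : s ^ (-(3 / 2) : ℝ) ≤ (σ / 2) ^ (-(3 / 2) : ℝ) :=
    Real.rpow_le_rpow_of_nonpos (by positivity) (by linarith) (by norm_num)
  gcongr
  linarith

theorem gaussian_le_K4 {n : ℕ} {t : ℝ} {x y : Rn n} {a σ : ℝ} (ht : 0 < t) (hx : x ≠ 0)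
    (ha : inner ℝ x y / ‖x‖ ^ 2 = a) (hσ : a = Real.exp (-σ)) (ha2 : a < 1 / 2)
    (haX : 1 < a * ‖x‖) (hσ0 : 0 < σ) :
    5 ^ ((n : ℝ) / 2) * t * (σ / 2) ^ (-(3 / 2) : ℝ) *
      Real.exp (-(t ^ 2 / (6 * σ) + ‖perp x y‖ ^ 2)) * √(Real.pi / ((a * ‖x‖) ^ 2 / 4)) ≤
      5 ^ ((n : ℝ) / 2) * 2 ^ (3 / 2 : ℝ) * √(4 * Real.pi) * K4 (1 / 8000) t x y := by
  have hX : 0 < ‖x‖ := norm_pos_iff.2 hx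
  have ha0 : 0 < a := hσ ▸ Real.exp_pos _
  have hn : ‖par x y‖ = a * ‖x‖ := by
    rw [par_eq_smul hx, ha, norm_smul, Real.norm_of_nonneg ha0.le]
  have hi : inner ℝ x y = a * ‖x‖ ^ 2 := by rw [← ha]; field_simp
  have hmem : y ∈ {z : Rn n | 0 < inner ℝ x z ∧ 1 < ‖par x z‖ ∧ ‖par x z‖ < ‖x‖ / 2} := by
    refine ⟨?_, ?_, ?_⟩
    · rw [hi]; positivity
    · rw [hn]; exact haX
    · rw [hn]; nlinarith
  have hlog : Real.log (‖x‖ / (a * ‖x‖)) = σ := by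
    rw [div_mul_cancel_right₀ hX.ne', hσ, ← Real.exp_neg, neg_neg, Real.log_exp]
  rw [K4, Set.indicator_of_mem hmem, hn, hlog, expStar, expStar]
  have hpow : (σ / 2) ^ (-(3 / 2) : ℝ) = 2 ^ (3 / 2 : ℝ) * σ ^ (-(3 / 2) : ℝ) := by
    rw [Real.div_rpow hσ0.le (by norm_num), div_eq_mul_inv, ← Real.rpow_neg (by norm_num), mul_comm,
      neg_neg]
  have hsqrt : √(Real.pi / ((a * ‖x‖) ^ 2 / 4)) = √(4 * Real.pi) / (a * ‖x‖) := by
    rw [show Real.pi / ((a * ‖x‖) ^ 2 / 4) = 4 * Real.pi / (a * ‖x‖) ^ 2 by field_simp,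
      Real.sqrt_div (by positivity), Real.sqrt_sq (by positivity)]
  have hexp : Real.exp (-(t ^ 2 / (6 * σ) + ‖perp x y‖ ^ 2)) ≤
      Real.exp (-(1 / 8000 * (t ^ 2 / σ))) * Real.exp (-(1 / 8000 * ‖perp x y‖ ^ 2)) := by
    rw [← Real.exp_add]
    refine Real.exp_le_exp.2 ?_
    have e : t ^ 2 / (6 * σ) = 1 / 6 * (t ^ 2 / σ) := by field_simp
    have : 0 ≤ t ^ 2 / σ := by positivity
    nlinarith [sq_nonneg ‖perp x y‖]
  rw [hpow, hsqrt]
  calc _ ≤ 5 ^ ((n : ℝ) / 2) * t * (2 ^ (3 / 2 : ℝ) * σ ^ (-(3 / 2) : ℝ)) *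
        (Real.exp (-(1 / 8000 * (t ^ 2 / σ))) * Real.exp (-(1 / 8000 * ‖perp x y‖ ^ 2))) *
        (√(4 * Real.pi) / (a * ‖x‖)) := by gcongr
    _ = _ := by ring

/-! ### Combination of the regions -/

theorem exists_poissonKernel_le (n : ℕ) :
    ∃ C > (0 : ℝ), ∀ t > (0 : ℝ), ∀ x y : Rn n,
      poissonKernel t x y ≤ C * (K1 (1 / 8000) t x y + K2 (1 / 8000) t x y
        + K3 (1 / 8000) t y + K4 (1 / 8000) t x y) := by
  obtain ⟨C₀, hC₀, hmaj⟩ := exists_poissonIntegrand_le_majorants n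
  obtain ⟨C', hC', hker⟩ := exists_poissonKernel_le_of_poissonIntegrand_le n
    (c := 1 / 8000) (by norm_num) hC₀
  obtain ⟨C₂, hC₂, hK2⟩ := exists_gaussian_le_K2 n
  set C₄ : ℝ := 5 ^ ((n : ℝ) / 2) * 2 ^ (3 / 2 : ℝ) * √(4 * Real.pi)
  have hC₄ : 0 < C₄ := by positivity
  refine ⟨C' + C₂ + C₄, by positivity, fun t ht x y => ?_⟩
  have k1 := K1_nonneg (c := 1 / 8000) ht x y
  have k2 := K2_nonneg (c := 1 / 8000) ht x y
  have k3 := K3_nonneg (c := 1 / 8000) ht y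
  have k4 := K4_nonneg (c := 1 / 8000) ht x y
  suffices h : poissonKernel t x y ≤ C' * (K1 (1 / 8000) t x y + K3 (1 / 8000) t y) +
      C₂ * K2 (1 / 8000) t x y + C₄ * K4 (1 / 8000) t x y by
    have : 0 ≤ C' * (K2 (1 / 8000) t x y + K4 (1 / 8000) t x y) := by positivity
    have : 0 ≤ C₂ * (K1 (1 / 8000) t x y + K3 (1 / 8000) t y + K4 (1 / 8000) t x y) := by
      positivity
    have : 0 ≤ C₄ * (K1 (1 / 8000) t x y + K3 (1 / 8000) t y + K2 (1 / 8000) t x y) := by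
      positivity
    linarith
  have h2 : 0 ≤ C₂ * K2 (1 / 8000) t x y := by positivity
  have h4 : 0 ≤ C₄ * K4 (1 / 8000) t x y := by positivity
  have hmaj0 : ∀ s, 0 < s → 0 ≤ C₀ * localMajorant (1 / 8000) t x y s +
      C₀ * globalMajorant (1 / 8000) t y s := fun s hs =>
    add_nonneg (mul_nonneg hC₀.le (localMajorant_nonneg ht x y hs))
      (mul_nonneg hC₀.le (globalMajorant_nonneg ht y hs))
  have regular : (∀ s, 0 < s →
      (s ≤ 2 ∧ (‖x - y‖ ^ 2 + s ^ 2 * ‖x‖ ^ 2) / 2000 ≤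
          ‖y - Real.exp (-s) • x‖ ^ 2 + 4 * s) ∨
        (1 / 4 ≤ s ∧ ‖y‖ ^ 2 / 50 ≤ ‖y - Real.exp (-s) • x‖ ^ 2 + 1) ∨
        (s ≤ 1 / 4 ∧ ‖y‖ ^ 2 / 8 + 1 / 32 ≤ ‖y - Real.exp (-s) • x‖ ^ 2)) →
      poissonKernel t x y ≤ C' * (K1 (1 / 8000) t x y + K3 (1 / 8000) t y) +
        C₂ * K2 (1 / 8000) t x y + C₄ * K4 (1 / 8000) t x y := by
    intro h
    have := hker t x y 0 1 0 ht le_rfl one_pos fun s hs => by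
      simpa using hmaj t x y s ht hs (h s hs)
    rw [zero_mul, add_zero] at this
    linarith
  rcases le_or_gt ‖x‖ 1 with hx | hx
  · exact regular fun s hs => or_assoc.1 (Or.inl (local_or_global_of_norm_le_one hx y hs))
  have hx0 : x ≠ 0 := norm_pos_iff.1 (by linarith)
  obtain ⟨a, ha⟩ : ∃ a, inner ℝ x y / ‖x‖ ^ 2 = a := ⟨_, rfl⟩
  rcases le_or_gt a 0 with ha0 | ha0
  · exact regular fun s hs => or_assoc.1 (Or.inl (local_or_global_of_nonpos hx0 ha ha0 hs))
  rcases le_or_gt 1 a with ha1 | ha1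
  · exact regular fun s hs => or_assoc.1 (Or.inl (local_or_global_of_one_le hx0 ha ha1 hs))
  obtain ⟨σ, hσ⟩ : ∃ σ, a = Real.exp (-σ) :=
    ⟨-Real.log a, by rw [neg_neg, Real.exp_log ha0]⟩
  have hσ0 : 0 < σ := by
    have := hσ ▸ ha1
    simpa using this
  have hX : 0 < ‖x‖ := by linarith
  rcases le_or_gt (1 / 2) a with ha2 | ha2
  · have hσ1 : σ ≤ 1 := by
      have h1 := exp_neg_le_inv_one_add hσ0
      rw [← hσ] at h1
      have := ha2.trans h1
      rw [div_le_div_iff₀ (by norm_num) (by linarith)] at this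
      linarith
    have := hker t x y (3 ^ ((n : ℝ) / 2) * t * (σ / 2) ^ (-(((n : ℝ) + 1) / 2) - 1) *
      Real.exp (-((t ^ 2 + ‖perp x y‖ ^ 2) / (6 * σ)))) (‖x‖ ^ 2 / (192 * σ)) σ ht
      (by positivity) (by positivity) fun s hs => by
      rcases le_total (|s - σ|) (σ / 2) with h | h
      · have := poissonIntegrand_le_gaussian_of_half_le ht hx0 ha hσ ha2 hσ0 hσ1 h
        linarith [hmaj0 s hs]
      · have := hmaj t x y s ht hs
          (or_assoc.1 (Or.inl (local_or_global_of_half_le hx0 ha hσ ha2 hσ0 hs h)))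
        exact this.trans (le_add_of_nonneg_right (by positivity))
    linarith [hK2 t x y a σ ht hx ha hσ ha2 hσ0 hσ1]
  rcases le_or_gt (a * ‖x‖) 1 with haX | haX
  · exact regular fun s _ => Or.inr (cases_of_lt_half hx ha hσ ha2 (Or.inl haX))
  have hσ1 : 1 / 2 ≤ σ := by
    have := Real.add_one_le_exp (-σ)
    linarith
  have := hker t x y (5 ^ ((n : ℝ) / 2) * t * (σ / 2) ^ (-(3 / 2) : ℝ) *
    Real.exp (-(t ^ 2 / (6 * σ) + ‖perp x y‖ ^ 2))) ((a * ‖x‖) ^ 2 / 4) σ ht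
    (by positivity) (by positivity) fun s hs => by
    rcases le_total (|s - σ|) (1 / 4) with h | h
    · have := poissonIntegrand_le_gaussian_of_lt_half ht hx0 ha hσ hσ1 h
      linarith [hmaj0 s hs]
    · have := hmaj t x y s ht hs (Or.inr (cases_of_lt_half hx ha hσ ha2 (Or.inr h)))
      exact this.trans (le_add_of_nonneg_right (by positivity))
  linarith [gaussian_le_K4 ht hx0 ha hσ ha2 haX hσ0]

end

end OrnsteinUhlenbeck

theorem theorem1p2 (n : ℕ) (hn : 1 ≤ n) :
    ∃ C > (0 : ℝ), ∃ c > (0 : ℝ), ∀ t > (0 : ℝ), ∀ x y : EuclideanSpace ℝ (Fin n),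
      OrnsteinUhlenbeck.poissonKernel t x y ≤
        C * (OrnsteinUhlenbeck.K1 c t x y + OrnsteinUhlenbeck.K2 c t x y
          + OrnsteinUhlenbeck.K3 c t y + OrnsteinUhlenbeck.K4 c t x y) := by
  obtain ⟨C, hC, h⟩ := OrnsteinUhlenbeck.exists_poissonKernel_le n
  exact ⟨C, hC, 1 / 8000, by norm_num, h⟩
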